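/- Let $m>0$ and $\gamma\in(0,2)$, and let $k_m(z)=\frac12\int_0^\infty e^{-\frac{m^2}{2s}|z|^2-\frac s2}\,ds$ for $z\in\mathbb C$. Let $(c_n)_{n\ge 0}$ be a strictly increasing sequence of real numbers with $c_0=1$ and $c_n\to\infty$, and let $(\eta_n)_{n\ge1}$ be independent, continuous, centered Gaussian fields on $\mathbb C$, defined on a probability space $(\Omega,\mathcal A,\mathbb P)$, with $$\mathbb E[\eta_n(x)\eta_n(y)]=\int_{c_{n-1}}^{c_n}\frac{k_m(u(x-y))}{u}\,du\qquad\text{for all }x,y\in\mathbb C .$$ Put $X_n=\sum_{k=1}^n\eta_k$ and $M_n(dz)=\exp\left(\gamma X_n(z)-\frac{\gamma^2}{2}\mathbb E[X_n(z)^2]\right)dz$, where $dz$ is Lebesgue measure on $\mathbb C$. Let $M$ be the Liouville measure of the massive Gaussian free field $\sum_{n\ge1}\eta_n$ with parameter $\gamma$, that is, the random Radon measure on $\mathbb C$ to which $M_n$ almost surely converges vaguely. Then for every $\varepsilon>0$, almost surely there is a (random) constant $C>0$ such that, with $B_R=\{z\in\mathbb C:|z|\le R\}$, $$M(B_R)\le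 C\,R^{2+\varepsilon}\qquad\text{for all }R\ge 1 .$$ -/

import Mathlib

namespace LiouvilleQG

open MeasureTheory ProbabilityTheory Filter Topology

/-- The continuous covariance kernel
`k_m(z) = (1/2) ∫₀^∞ exp (-(m² / (2 s)) |z|² - s / 2) ds`, for which the Green function of the
massive free field is `G_m(x, y) = ∫₁^∞ k_m(u (x - y)) / u du`. -/
noncomputable def kernel (m : ℝ) (z : ℂ) : ℝ :=
  (1 / 2) * ∫ s in Set.Ioi (0 : ℝ), Real.exp (-(m ^ 2 / (2 * s)) * ‖z‖ ^ 2 - s / 2)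

/-- `c` is an admissible sequence of cut-offs: strictly increasing, `c₀ = 1`, tending to infinity. -/
structure IsCutoffSequence (c : ℕ → ℝ) : Prop where
  zero : c 0 = 1
  strictMono : StrictMono c
  tendsto : Tendsto c atTop atTop

/-- `η` is a decomposition of the whole-plane massive Gaussian free field of mass `m` along the
cut-offs `c`: independent, continuous, centered Gaussian fields on `ℂ`, where the field `η n` has
covariance `∫_{c n}^{c (n+1)} k_m(u (x - y)) / u du`. (The index starts at `0`: `η n` is the field
usually written `η_{n+1}`.) -/
structure IsMassiveGFFDecomposition {Ω : Type*} [MeasurableSpace Ω] (P : Measure Ω)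
    (m : ℝ) (c : ℕ → ℝ) (η : ℕ → ℂ → Ω → ℝ) : Prop where
  measurable : ∀ n x, Measurable (η n x)
  continuous : ∀ n ω, Continuous fun x => η n x ω
  gaussian : ∀ n, IsGaussianProcess (η n) P
  centered : ∀ n x, ∫ ω, η n x ω ∂P = 0
  covariance : ∀ n x y, ∫ ω, η n x ω * η n y ω ∂P =
    ∫ u in (c n)..(c (n + 1)), kernel m ((u : ℂ) * (x - y)) / u
  indep : iIndepFun (fun n ω x => η n x ω) P

/-- The `n`-regularized field `X_n`, the sum of the first `n` fields. -/
def regularizedField {Ω : Type*} (η : ℕ → ℂ → Ω → ℝ) (n : ℕ) (z : ℂ) (ω : Ω) : ℝ :=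
  ∑ k ∈ Finset.range n, η k z ω

/-- The `n`-regularized measure `M_n(dz) = exp (γ X_n(z) - (γ² / 2) E[X_n(z)²]) dz`. -/
noncomputable def regularizedMeasure {Ω : Type*} [MeasurableSpace Ω] (P : Measure Ω)
    (γ : ℝ) (η : ℕ → ℂ → Ω → ℝ) (n : ℕ) (ω : Ω) : Measure ℂ :=
  (volume : Measure ℂ).withDensity fun z =>
    ENNReal.ofReal (Real.exp (γ * regularizedField η n z ω
      - γ ^ 2 / 2 * ∫ ω', regularizedField η n z ω' ^ 2 ∂P))

/-- Vague convergence of a sequence of measures on `ℂ` to a Radon measure. (On `ℂ`, Borel measures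
that are locally finite are Radon.) -/
def TendstoVaguely (μ : ℕ → Measure ℂ) (ν : Measure ℂ) : Prop :=
  IsLocallyFiniteMeasure ν ∧
    ∀ f : ℂ → ℝ, Continuous f → HasCompactSupport f →
      Tendsto (fun n => ∫ z, f z ∂(μ n)) atTop (𝓝 (∫ z, f z ∂ν))

/-- `M` is (a version of) the Liouville measure with parameter `γ` constructed from `η`: almost
surely, it is the vague limit of the regularized measures. -/
def IsLiouvilleMeasure {Ω : Type*} [MeasurableSpace Ω] (P : Measure Ω)
    (γ : ℝ) (η : ℕ → ℂ → Ω → ℝ) (M : Ω → Measure ℂ) : Prop :=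
  ∀ᵐ ω ∂P, TendstoVaguely (fun n => regularizedMeasure P γ η n ω) (M ω)

end LiouvilleQG

namespace LiouvilleQG

open MeasureTheory ProbabilityTheory Filter Topology

variable {Ω : Type*} [MeasurableSpace Ω] {P : Measure Ω} {m γ : ℝ} {c : ℕ → ℝ}
  {η : ℕ → ℂ → Ω → ℝ}

/-! Only first moments matter. Each density has mean one, so `M_n` of a Borel set has its Lebesgue
measure as mean. By Fatou the liminf over `n` of the masses of the disc of radius `2 ^ (k + 1)` has
mean at most `4π * 4 ^ k`, and this liminf dominates the mass `M` gives to compact subsets of the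
disc. Since `4 < 2 ^ (2 + ε)`, weighting by `2 ^ (-(2 + ε) k)` makes the means summable, so almost
surely one constant serves all dyadic radii; monotonicity in `R` fills the gaps. -/

/-- The density of the regularized measure `M_n` with respect to Lebesgue measure. -/
noncomputable def regularizedDensity (P : Measure Ω) (γ : ℝ) (η : ℕ → ℂ → Ω → ℝ) (n : ℕ) (z : ℂ)
    (ω : Ω) : ℝ :=
  Real.exp (γ * regularizedField η n z ω - γ ^ 2 / 2 * ∫ ω', regularizedField η n z ω' ^ 2 ∂P)

namespace IsMassiveGFFDecomposition

lemma measurable_regularizedField (hη : IsMassiveGFFDecomposition P m c η) (n : ℕ) (z : ℂ) :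
    Measurable (regularizedField η n z) :=
  Finset.measurable_fun_sum _ fun k _ => hη.measurable k z

lemma measurable_uncurry_regularizedField (hη : IsMassiveGFFDecomposition P m c η) (n : ℕ) :
    Measurable (Function.uncurry (regularizedField η n)) :=
  measurable_uncurry_of_continuous_of_measurable
    (fun ω => continuous_finsetSum _ fun k _ => hη.continuous k ω)
    (hη.measurable_regularizedField n)

lemma measurable_uncurry_regularizedDensity [SFinite P] (hη : IsMassiveGFFDecomposition P m c η)
    (n : ℕ) : Measurable (Function.uncurry (regularizedDensity P γ η n)) := by
  have h := hη.measurable_uncurry_regularizedField n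
  have h2 : Measurable fun z => ∫ ω', regularizedField η n z ω' ^ 2 ∂P :=
    ((h.pow_const 2).stronglyMeasurable.integral_prod_right (ν := P)).measurable
  exact ((h.const_mul γ).sub ((h2.comp measurable_fst).const_mul (γ ^ 2 / 2))).exp

lemma hasGaussianLaw_regularizedField (hη : IsMassiveGFFDecomposition P m c η) (n : ℕ) (z : ℂ) :
    HasGaussianLaw (regularizedField η n z) P := by
  have h1 : iIndepFun (fun k ω => η k z ω) P :=
    hη.indep.comp (fun _ f => f z) fun _ => measurable_pi_apply z
  have h2 : iIndepFun (fun (k : Fin n) ω => η k z ω) P := h1.precomp Fin.val_injective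
  have h3 := iIndepFun.hasGaussianLaw_fun_sum
    (fun k : Fin n => (hη.gaussian k).hasGaussianLaw_eval z) h2
  have h4 : regularizedField η n z = fun ω => ∑ k : Fin n, η k z ω :=
    funext fun ω => Finset.sum_range fun k => η k z ω
  rwa [h4]

lemma integral_regularizedField (hη : IsMassiveGFFDecomposition P m c η) (n : ℕ) (z : ℂ) :
    ∫ ω, regularizedField η n z ω ∂P = 0 := by
  simp only [regularizedField]
  rw [integral_finsetSum _ fun k _ => ((hη.gaussian k).hasGaussianLaw_eval z).integrable]
  exact Finset.sum_eq_zero fun k _ => hη.centered k z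

/-- The exponent subtracts exactly the log-Laplace transform at `γ` of the centered Gaussian
variable `X_n(z)`. -/
lemma lintegral_regularizedDensity (hη : IsMassiveGFFDecomposition P m c η) (n : ℕ) (z : ℂ) :
    ∫⁻ ω, ENNReal.ofReal (regularizedDensity P γ η n z ω) ∂P = 1 := by
  have hG := hη.hasGaussianLaw_regularizedField n z
  have := hG.isProbabilityMeasure
  have hmap := hG.map_eq_gaussianReal
  rw [hη.integral_regularizedField, variance_of_integral_eq_zero hG.aemeasurable
    (hη.integral_regularizedField n z)] at hmap
  have hmgf := mgf_gaussianReal hmap γ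
  have hnn : 0 ≤ ∫ ω, regularizedField η n z ω ^ 2 ∂P := integral_nonneg fun _ => sq_nonneg _
  rw [Real.coe_toNNReal _ hnn] at hmgf
  -- A non-integrable exponential would have `mgf` equal to `0` by convention, so positivity gives
  -- integrability.
  have hint : Integrable (fun ω => Real.exp (γ * regularizedField η n z ω)) P := by
    rw [← mgf_pos_iff, hmgf]
    exact Real.exp_pos _
  have hd : regularizedDensity P γ η n z = fun ω => Real.exp (γ * regularizedField η n z ω) *
      Real.exp (-(γ ^ 2 / 2 * ∫ ω', regularizedField η n z ω' ^ 2 ∂P)) := by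
    ext ω
    rw [regularizedDensity, ← Real.exp_add, sub_eq_add_neg]
  rw [hd, ← ofReal_integral_eq_lintegral_ofReal (hint.mul_const _)
    (ae_of_all _ fun _ => by positivity), integral_mul_const]
  change ENNReal.ofReal (mgf (regularizedField η n z) P γ * _) = 1
  rw [hmgf, ← Real.exp_add, ENNReal.ofReal_eq_one, Real.exp_eq_one_iff]
  ring

lemma measurable_regularizedMeasure_apply [SFinite P] (hη : IsMassiveGFFDecomposition P m c η)
    (n : ℕ) {s : Set ℂ} (hs : MeasurableSet s) :
    Measurable fun ω => regularizedMeasure P γ η n ω s := by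
  simp only [regularizedMeasure, withDensity_apply _ hs]
  exact (hη.measurable_uncurry_regularizedDensity (γ := γ) n).ennreal_ofReal.lintegral_prod_left'

/-- The regularized measures have Lebesgue measure as their mean. -/
lemma lintegral_regularizedMeasure_apply [SFinite P] (hη : IsMassiveGFFDecomposition P m c η)
    (n : ℕ) {s : Set ℂ} (hs : MeasurableSet s) :
    ∫⁻ ω, regularizedMeasure P γ η n ω s ∂P = volume s := by
  simp only [regularizedMeasure, withDensity_apply _ hs]
  rw [lintegral_lintegral_swap]
  · exact (lintegral_congr fun z => hη.lintegral_regularizedDensity n z).trans (by simp)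
  · exact ((hη.measurable_uncurry_regularizedDensity (γ := γ) n).comp
      measurable_swap).ennreal_ofReal.aemeasurable

/-- Fatou's lemma. The liminf is measurable in `ω`, whereas no measurability of `M` is assumed. -/
lemma lintegral_liminf_regularizedMeasure_le [SFinite P] (hη : IsMassiveGFFDecomposition P m c η)
    {s : Set ℂ} (hs : MeasurableSet s) :
    ∫⁻ ω, liminf (fun n => regularizedMeasure P γ η n ω s) atTop ∂P ≤ volume s := by
  refine (lintegral_liminf_le fun n => hη.measurable_regularizedMeasure_apply n hs).trans ?_
  simp [hη.lintegral_regularizedMeasure_apply _ hs]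

end IsMassiveGFFDecomposition

/-- Portmanteau-type bound for vague limits. -/
lemma TendstoVaguely.measure_le_liminf {μ : ℕ → Measure ℂ} {ν : Measure ℂ}
    (h : TendstoVaguely μ ν) {K U : Set ℂ} (hK : IsCompact K) (hU : IsOpen U) (hKU : K ⊆ U) :
    ν K ≤ liminf (fun n => μ n U) atTop := by
  obtain ⟨hν, h⟩ := h
  obtain ⟨f, hfK, hfU, hfc, hf⟩ := exists_continuous_one_zero_of_isCompact hK hU.isClosed_compl
    (Set.disjoint_compl_right_iff_subset.2 hKU)
  have hνf : ν K ≤ ENNReal.ofReal (∫ z, f z ∂ν) := by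
    rw [ofReal_integral_eq_lintegral_ofReal (f.continuous.integrable_of_hasCompactSupport hfc)
      (ae_of_all _ fun z => (hf z).1), ← lintegral_indicator_one hK.measurableSet]
    refine lintegral_mono fun z => Set.indicator_le (g := fun z => ENNReal.ofReal (f z)) (fun x hx => ?_) z
    simp [hfK hx]
  have hlim := (ENNReal.continuous_ofReal.tendsto _).comp (h f f.continuous hfc)
  refine hνf.trans (hlim.liminf_eq.ge.trans (liminf_le_liminf (Eventually.of_forall fun n => ?_)))
  exact integral_le_measure (fun z _ => (hf z).2) fun z hz => (hfU hz).le

end LiouvilleQG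

open MeasureTheory Filter in
/-- If `L k` has mean of order `4 ^ k`, then almost surely `L k` is of order `2 ^ (k (2 + ε))`. -/
lemma ae_exists_forall_le_of_lintegral_le_four_pow {Ω : Type*} [MeasurableSpace Ω] {P : Measure Ω}
    {L : ℕ → Ω → ENNReal} (hL : ∀ k, Measurable (L k)) {A : ℝ}
    (hLA : ∀ k, ∫⁻ ω, L k ω ∂P ≤ ENNReal.ofReal (A * 4 ^ k)) {ε : ℝ} (hε : 0 < ε) :
    ∀ᵐ ω ∂P, ∃ C : ℝ, 0 < C ∧ ∀ k, L k ω ≤ ENNReal.ofReal (C * ((2 : ℝ) ^ (2 + ε)) ^ k) := by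
  set b : ℝ := (2 : ℝ) ^ (2 + ε) with hb
  have hb4 : 4 < b := by
    have := Real.rpow_lt_rpow_of_exponent_lt (x := 2) (by norm_num) (by linarith : 2 < 2 + ε)
    norm_num at this
    exact this
  have hb0 : 0 < b := by linarith
  -- The mean of the weighted series is at most the geometric sum of `A * (4 / b) ^ k`.
  have hfin : ∫⁻ ω, ∑' k, ENNReal.ofReal (b⁻¹ ^ k) * L k ω ∂P ≠ ⊤ := by
    rw [lintegral_tsum fun k => ((hL k).const_mul _).aemeasurable]
    have hs : Summable fun k : ℕ => A * (4 / b) ^ k :=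
      (summable_geometric_of_lt_one (by positivity) ((div_lt_one hb0).2 hb4)).mul_left A
    refine ne_top_of_le_ne_top hs.tsum_ofReal_ne_top (ENNReal.tsum_le_tsum fun k => ?_)
    rw [lintegral_const_mul _ (hL k)]
    refine (mul_le_mul_right (hLA k) _).trans_eq ?_
    rw [← ENNReal.ofReal_mul (by positivity)]
    congr 1
    rw [div_eq_mul_inv, mul_pow]
    ring
  filter_upwards [ae_lt_top (Measurable.tsum fun k => (hL k).const_mul _) hfin] with ω hω
  set S := ∑' k, ENNReal.ofReal (b⁻¹ ^ k) * L k ω with hS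
  -- Each term is at most the sum `S`; the `+ 1` only ensures strict positivity.
  refine ⟨S.toReal + 1, by positivity, fun k => ?_⟩
  have h1 : ENNReal.ofReal (b⁻¹ ^ k) * L k ω ≤ S := ENNReal.le_tsum k
  have hbk : ENNReal.ofReal (b ^ k) * ENNReal.ofReal (b⁻¹ ^ k) = 1 := by
    rw [← ENNReal.ofReal_mul (by positivity), ← mul_pow, mul_inv_cancel₀ hb0.ne']
    simp
  calc L k ω = ENNReal.ofReal (b ^ k) * (ENNReal.ofReal (b⁻¹ ^ k) * L k ω) := by
        rw [← mul_assoc, hbk, one_mul]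
    _ ≤ ENNReal.ofReal (b ^ k) * S := mul_le_mul_right h1 _
    _ = ENNReal.ofReal (S.toReal * b ^ k) := by
        rw [mul_comm, ENNReal.ofReal_mul ENNReal.toReal_nonneg, ENNReal.ofReal_toReal hω.ne]
    _ ≤ ENNReal.ofReal ((S.toReal + 1) * b ^ k) := by
        gcongr
        linarith

theorem mainTheorem9 {Ω : Type*} [MeasurableSpace Ω] (P : MeasureTheory.Measure Ω)
    [MeasureTheory.IsProbabilityMeasure P]
    (m γ : ℝ) (hm : 0 < m) (hγ : 0 < γ) (hγ' : γ < 2)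
    (c : ℕ → ℝ) (hc : LiouvilleQG.IsCutoffSequence c)
    (η : ℕ → ℂ → Ω → ℝ) (hη : LiouvilleQG.IsMassiveGFFDecomposition P m c η)
    (M : Ω → MeasureTheory.Measure ℂ) (hM : LiouvilleQG.IsLiouvilleMeasure P γ η M)
    (ε : ℝ) (hε : 0 < ε) :
    ∀ᵐ ω ∂P, ∃ C : ℝ, 0 < C ∧ ∀ R : ℝ, 1 ≤ R →
      M ω (Metric.closedBall 0 R) ≤ ENNReal.ofReal (C * R ^ (2 + ε)) := by
  have hLm : ∀ k : ℕ, Measurable fun ω => Filter.liminf (fun n =>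
      LiouvilleQG.regularizedMeasure P γ η n ω (Metric.ball 0 (2 ^ (k + 1)))) Filter.atTop :=
    fun k => .liminf fun n => hη.measurable_regularizedMeasure_apply n measurableSet_ball
  have hLA : ∀ k : ℕ, ∫⁻ ω, Filter.liminf (fun n =>
      LiouvilleQG.regularizedMeasure P γ η n ω (Metric.ball 0 (2 ^ (k + 1)))) Filter.atTop ∂P
        ≤ ENNReal.ofReal (4 * Real.pi * 4 ^ k) := fun k => by
    refine (hη.lintegral_liminf_regularizedMeasure_le measurableSet_ball).trans_eq ?_
    rw [Complex.volume_ball, ← ENNReal.ofReal_pow (by positivity), ← NNReal.coe_real_pi,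
      ← ENNReal.ofReal_coe_nnreal, ← ENNReal.ofReal_mul (by positivity), ← pow_mul, mul_comm _ 2,
      pow_mul]
    congr 1
    norm_num [pow_succ]
    ring
  filter_upwards [hM, ae_exists_forall_le_of_lintegral_le_four_pow hLm hLA hε] with ω hω hC
  obtain ⟨C, hC0, hC⟩ := hC
  -- With `2 ^ k ≤ R < 2 ^ (k + 1)`, the bound of index `k + 1` is applied, on the disc of radius `2
  -- ^ (k + 2)`; the shift costs the factor `2 ^ (2 + ε)`.
  refine ⟨C * 2 ^ (2 + ε), by positivity, fun R hR => ?_⟩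
  obtain ⟨k, hkR, hRk⟩ := exists_nat_pow_near hR one_lt_two
  refine (hω.measure_le_liminf (isCompact_closedBall 0 R) Metric.isOpen_ball
    (Metric.closedBall_subset_ball (hRk.trans (pow_lt_pow_right₀ one_lt_two
      (Nat.lt_succ_self (k + 1)))))).trans ((hC (k + 1)).trans (ENNReal.ofReal_le_ofReal ?_))
  have h : ((2 : ℝ) ^ (2 + ε)) ^ k ≤ R ^ (2 + ε) := by
    rw [Real.rpow_pow_comm zero_le_two]
    exact Real.rpow_le_rpow (by positivity) hkR (by linarith)
  rw [pow_succ', ← mul_assoc]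
  gcongr
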